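/- For each $n\ge 1$ let $T_{(1)}\le\dots\le T_{(n)}$ be the order statistics of $n$ i.i.d. random variables that are uniform on $[0,1]$, put $T_{(0)}:=0$, and let $T^n(s):=T_{(\lfloor ns\rfloor)}$ for $s\in[0,1]$. Fix $t\le 1$ and a partition $0=t_0<t_1<\dots<t_d=t$ of $[0,t]$, and let $$\mathbf\Delta_n:=\big(T^n(t_1)-T^n(t_0),\,T^n(t_2)-T^n(t_1),\,\dots,\,T^n(t_d)-T^n(t_{d-1})\big)\in\mathbb R^d .$$ For $x\in\mathbb R^{d+1}$ define $$\Lambda^*(x):=\sup_{\lambda}\Big\{\sum_{i=1}^d\big[(\lambda_i+\lambda_{d+1})x_i+(t_i-t_{i-1})\log(1-\lambda_i-\lambda_{d+1})\big]+\lambda_{d+1}x_{d+1}+(1-t)\log(1-\lambda_{d+1})\Big\},$$ the supremum being over all $\lambda\in\mathbb R^{d+1}$ with $\lambda_{d+1}<1$ and $\lambda_i+\lambda_{d+1}<1$ for $1\le i\le d$, and for $y\in\mathbb R^d$ let $$\hat\Lambda(y):=\inf\Big\{\Lambda^*(x): x\in\mathbb R^{d+1},\ \textstyle\sum_{k=1}^{d+1}x_k\ne0,\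 (x_1,\dots,x_d)/\sum_{k=1}^{d+1}x_k=y\Big\}.$$ Then $(\mathbf\Delta_n)_{n\ge1}$ satisfies the large deviations principle in $\mathbb R^d$ with speed $n$ and good rate function $\hat\Lambda$: $\hat\Lambda$ takes values in $[0,\infty]$, is lower semicontinuous with compact level sets $\{\hat\Lambda\le a\}$, $0\le a<\infty$, and $$\liminf_{n\to\infty}\tfrac1n\log\mathbb P(\mathbf\Delta_n\in G)\ge-\inf_G\hat\Lambda,\qquad \limsup_{n\to\infty}\tfrac1n\log\mathbb P(\mathbf\Delta_n\in F)\le-\inf_F\hat\Lambda$$ for all open $G$ and closed $F$ in $\mathbb R^d$. Furthermore, for every $y$ with all $y_i>0$ and $\sum_{l}y_l\le1$, $$\hat\Lambda(y)=\sum_{i=1}^d(t_i-t_{i-1})\log\frac{t_i-t_{i-1}}{y_i}+(1-t)\log\frac{1-t}{1-\sum_{l=1}^dy_l},$$ where the last term is $0$ if $t=1$ and $+\infty$ if $t<1$ and $\sum_l y_l=1$; and $\hat\Lambda(y)=+\infty$ for all other $y\in\mathbb R^d$. -/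

import Mathlib

open MeasureTheory ProbabilityTheory Filter Set
open scoped ENNReal

noncomputable section

namespace OrderStatLDP

/-- A good rate function on a topological space: a lower semicontinuous map into `[0, ∞]` whose
level sets at finite levels are compact. -/
structure IsGoodRateFunction {X : Type*} [TopologicalSpace X] (I : X → EReal) : Prop where
  nonneg : ∀ x, 0 ≤ I x
  lowerSemicontinuous : LowerSemicontinuous I
  isCompact_level : ∀ a : ℝ, 0 ≤ a → IsCompact {x | I x ≤ (a : EReal)}

/-- The large deviations principle with speed `n` and rate function `I` for a sequence of random
elements `Y n`: the liminf (limsup) of `(1 / n) * log P (Y n ∈ A)` is bounded below (above) by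
`- inf_A I` for every open (closed) set `A`.  The logarithm takes values in `[-∞, 0]`, with
`log 0 = -∞`. -/
structure SatisfiesLDP {Ω X : Type*} [MeasurableSpace Ω] [TopologicalSpace X]
    (P : Measure Ω) (Y : ℕ → Ω → X) (I : X → EReal) : Prop where
  lower : ∀ G : Set X, IsOpen G →
    -(⨅ x ∈ G, I x) ≤ liminf (fun n : ℕ => ENNReal.log (P {ω | Y n ω ∈ G}) / (n : EReal)) atTop
  upper : ∀ F : Set X, IsClosed F →
    limsup (fun n : ℕ => ENNReal.log (P {ω | Y n ω ∈ F}) / (n : EReal)) atTop ≤ -(⨅ x ∈ F, I x)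

/-- The `k`-th order statistic (the `k`-th smallest value, `1 ≤ k ≤ n`) of `x 0, …, x (n - 1)`,
with the convention that the `0`-th one is `0`.  (The value for `k > n` is never used.) -/
def orderStat {n : ℕ} (x : Fin n → ℝ) (k : ℕ) : ℝ :=
  if h : 0 < k ∧ k ≤ n then x (Tuple.sort x ⟨k - 1, by omega⟩) else 0

/-- The ordered statistics process `T^n(s) = T_(⌊n s⌋)` of the sample `x`. -/
def orderStatProcess {n : ℕ} (x : Fin n → ℝ) (s : ℝ) : ℝ :=
  orderStat x ⌊(n : ℝ) * s⌋₊

/-- The increments `T^n(τ_i) - T^n(τ_{i-1})`, `1 ≤ i ≤ d`, of the ordered statistics process over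
the partition `τ 0 < τ 1 < ⋯ < τ d`. -/
def increments {n d : ℕ} (τ : Fin (d + 1) → ℝ) (x : Fin n → ℝ) : Fin d → ℝ :=
  fun i => orderStatProcess x (τ i.succ) - orderStatProcess x (τ i.castSucc)

/-- The set of `θ ∈ ℝ^{d+1}` with `max_{i ≤ d} θ_i + θ_{d+1} < 1` and `θ_{d+1} < 1`. -/
def cumulantDomain (d : ℕ) : Set (Fin (d + 1) → ℝ) :=
  {θ | (∀ i : Fin d, θ i.castSucc + θ (Fin.last d) < 1) ∧ θ (Fin.last d) < 1}

/-- The convex conjugate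
`Λ*(x) = sup_θ ∑_{i ≤ d} ((θ_i + θ_{d+1}) x_i + (τ_i - τ_{i-1}) log (1 - θ_i - θ_{d+1}))
  + θ_{d+1} x_{d+1} + (1 - τ_d) log (1 - θ_{d+1})`,
a supremum in `[-∞, ∞]` over `cumulantDomain d`. -/
def conjugate {d : ℕ} (τ : Fin (d + 1) → ℝ) (x : Fin (d + 1) → ℝ) : EReal :=
  ⨆ θ ∈ cumulantDomain d,
    (((∑ i : Fin d, ((θ i.castSucc + θ (Fin.last d)) * x i.castSucc
          + (τ i.succ - τ i.castSucc) * Real.log (1 - θ i.castSucc - θ (Fin.last d))))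
        + θ (Fin.last d) * x (Fin.last d)
        + (1 - τ (Fin.last d)) * Real.log (1 - θ (Fin.last d)) : ℝ) : EReal)

/-- The map `Φ(x) = (x_1, …, x_d) / (x_1 + ⋯ + x_{d+1})`, used where the denominator is nonzero. -/
def normalize {d : ℕ} (x : Fin (d + 1) → ℝ) : Fin d → ℝ :=
  fun i => x i.castSucc / ∑ k, x k

/-- The contracted function `y ↦ inf {Λ*(x) : Φ(x) = y}`. -/
def contractedRate {d : ℕ} (τ : Fin (d + 1) → ℝ) (y : Fin d → ℝ) : EReal :=
  ⨅ x ∈ {x : Fin (d + 1) → ℝ | ∑ k, x k ≠ 0 ∧ normalize x = y}, conjugate τ x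

/-- `a log (a / x)` for `a ≥ 0`, with the usual conventions: it is `0` for `a = 0` and `x ≥ 0`,
and `+∞` for `a > 0 = x` and for `x < 0`. -/
def logTerm (a x : ℝ) : EReal :=
  if 0 < x ∨ (a = 0 ∧ x = 0) then ((a * Real.log (a / x) : ℝ) : EReal) else ⊤

/-- The explicit rate `∑_{i ≤ d} (τ_i - τ_{i-1}) log ((τ_i - τ_{i-1}) / y_i)
  + (1 - τ_d) log ((1 - τ_d) / (1 - ∑_l y_l))`. -/
def explicitRate {d : ℕ} (τ : Fin (d + 1) → ℝ) (y : Fin d → ℝ) : EReal :=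
  (∑ i : Fin d, logTerm (τ i.succ - τ i.castSucc) (y i))
    + logTerm (1 - τ (Fin.last d)) (1 - ∑ l, y l)

end OrderStatLDP

end

/-! Write w for the cell masses τ_i - τ_{i-1} and 1 - τ_d, z for (y, 1 - ∑ y), and S_j for the sum
of the z_k with k < j.

Rate function. In the variables b = 1 - μ the supremum defining Λ* splits into one-dimensional
problems, the j-th being solved by b_j = w_j / x_j. On the ray x = s z the value is (s - 1 - log s)
plus the relative entropy ∑ w_j log (w_j / z_j), and s - 1 - log s ≥ 0 vanishes at s = 1. So the
contracted rate is the entropy, and also equals Λ*(z) (`contractedRate_eq_explicitRate`,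
`conjugate_completion`).

Large deviations. These come from direct counting rather than a contraction principle. The
increments are near y when each T_(⌊n τ_j⌋) is near S_j, that is, when a prescribed number m_j ~ n
w_j of sample points falls roughly into the interval (S_j, S_j + z_j]. There are n! / ∏ m_j!
assignments of points to intervals, each of probability about ∏ z_j ^ m_j, and by Stirling the
product decays at the entropy rate (`tendsto_log_multinomial_mul_prod_div`). The upper bound is a
union bound over assignments with widened intervals (`measure_increments_near_le`), followed by
compactness of the simplex. For the lower bound the assignments are disjoint events, and pinning one
point per cell near its right end costs only a factor δ ^ d (`le_measure_increments_near`). -/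

open scoped Topology

namespace OrderStatLDP

/-! ### Cell weights and partial sums -/

/-- The weights `τ_i - τ_{i-1}` (`1 ≤ i ≤ d`) and `1 - τ_d` of the cells of the partition. -/
def weights {d : ℕ} (τ : Fin (d + 1) → ℝ) : Fin (d + 1) → ℝ :=
  Fin.snoc (α := fun _ => ℝ) (fun i => τ i.succ - τ i.castSucc) (1 - τ (Fin.last d))

/-- The vector `(y_1, …, y_d, 1 - ∑ y_l)`. -/
def completion {d : ℕ} (y : Fin d → ℝ) : Fin (d + 1) → ℝ :=
  Fin.snoc (α := fun _ => ℝ) y (1 - ∑ l, y l)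

@[simp] theorem weights_castSucc {d : ℕ} (τ : Fin (d + 1) → ℝ) (i : Fin d) :
    weights τ i.castSucc = τ i.succ - τ i.castSucc := by simp [weights]

@[simp] theorem weights_last {d : ℕ} (τ : Fin (d + 1) → ℝ) :
    weights τ (Fin.last d) = 1 - τ (Fin.last d) := by simp [weights]

@[simp] theorem completion_castSucc {d : ℕ} (y : Fin d → ℝ) (i : Fin d) :
    completion y i.castSucc = y i := by simp [completion]

@[simp] theorem completion_last {d : ℕ} (y : Fin d → ℝ) :
    completion y (Fin.last d) = 1 - ∑ l, y l := by simp [completion]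

theorem sum_completion {d : ℕ} (y : Fin d → ℝ) : ∑ j, completion y j = 1 := by
  simp [Fin.sum_univ_castSucc]

theorem continuous_completion {d : ℕ} : Continuous (completion (d := d)) := by
  refine continuous_pi fun j => ?_
  induction j using Fin.lastCases with
  | last => simp only [completion_last]; fun_prop
  | cast i => simp only [completion_castSucc]; fun_prop

theorem sum_Iio_succ {d : ℕ} (w : Fin (d + 1) → ℝ) (l : Fin d) :
    ∑ k ∈ Finset.Iio l.succ, w k = ∑ k ∈ Finset.Iio l.castSucc, w k + w l.castSucc := by
  have : Finset.Iio l.succ = insert l.castSucc (Finset.Iio l.castSucc) := by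
    ext k
    simp only [Finset.mem_Iio, Finset.mem_insert, Fin.lt_def, Fin.ext_iff, Fin.val_succ,
      Fin.val_castSucc]
    omega
  rw [this, Finset.sum_insert (by simp), add_comm]

theorem sum_Iio_last {d : ℕ} (w : Fin (d + 1) → ℝ) :
    ∑ k ∈ Finset.Iio (Fin.last d), w k + w (Fin.last d) = ∑ k, w k := by
  have : (Finset.univ : Finset (Fin (d + 1))) =
      insert (Fin.last d) (Finset.Iio (Fin.last d)) := by
    ext k
    simp only [Finset.mem_univ, Finset.mem_insert, Finset.mem_Iio, true_iff]
    exact (Fin.le_last k).eq_or_lt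
  rw [this, Finset.sum_insert (by simp), add_comm]

/-- Telescoping. It serves both for g = τ and for g_j the order statistic of rank ⌊n τ_j⌋. -/
theorem sum_Iio_eq_sub {d : ℕ} (g w : Fin (d + 1) → ℝ)
    (hw : ∀ l : Fin d, w l.castSucc = g l.succ - g l.castSucc) (j : Fin (d + 1)) :
    ∑ k ∈ Finset.Iio j, w k = g j - g 0 := by
  induction j using Fin.induction with
  | zero =>
    have : Finset.Iio (0 : Fin (d + 1)) = ∅ := by ext k; simp
    simp [this]
  | succ l ih => rw [sum_Iio_succ, ih, hw]; ring

theorem sum_weights {d : ℕ} {τ : Fin (d + 1) → ℝ} (hτ0 : τ 0 = 0) : ∑ j, weights τ j = 1 := by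
  rw [← sum_Iio_last, sum_Iio_eq_sub τ _ (weights_castSucc τ), hτ0, weights_last]
  ring

theorem weights_castSucc_pos {d : ℕ} {τ : Fin (d + 1) → ℝ} (hτ : StrictMono τ) (i : Fin d) :
    0 < weights τ i.castSucc := by
  rw [weights_castSucc]
  exact sub_pos.2 (hτ Fin.castSucc_lt_succ)

theorem weights_nonneg {d : ℕ} {τ : Fin (d + 1) → ℝ} (hτ : StrictMono τ)
    (h1 : τ (Fin.last d) ≤ 1) (j : Fin (d + 1)) : 0 ≤ weights τ j := by
  induction j using Fin.lastCases with
  | last => simpa using h1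
  | cast i => exact (weights_castSucc_pos hτ i).le

/-! ### The convex conjugate and its contraction -/

/-- `Λ*` is the supremum over `b = 1 - μ > 0`, where `μ_i = θ_i + θ_{d+1}` and
`μ_{d+1} = θ_{d+1}`. -/
theorem conjugate_eq_iSup {d : ℕ} (τ : Fin (d + 1) → ℝ) (x : Fin (d + 1) → ℝ) :
    conjugate τ x = ⨆ b ∈ {b : Fin (d + 1) → ℝ | ∀ j, 0 < b j},
      ((∑ j, (x j - b j * x j + weights τ j * Real.log (b j)) : ℝ) : EReal) := by
  apply le_antisymm
  · refine iSup₂_le fun θ hθ => ?_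
    let b : Fin (d + 1) → ℝ := Fin.snoc (α := fun _ => ℝ)
      (fun i => 1 - θ i.castSucc - θ (Fin.last d)) (1 - θ (Fin.last d))
    have hb : b ∈ {b : Fin (d + 1) → ℝ | ∀ j, 0 < b j} := by
      intro j
      induction j using Fin.lastCases with
      | last => simpa [b] using hθ.2
      | cast i => simp only [b, Fin.snoc_castSucc]; linarith [hθ.1 i]
    refine le_trans (le_of_eq ?_) (le_iSup₂ b hb)
    congr 1
    rw [Fin.sum_univ_castSucc]
    simp only [b, Fin.snoc_castSucc, Fin.snoc_last, weights_castSucc, weights_last]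
    rw [add_assoc]
    congr 1
    · refine Finset.sum_congr rfl fun i _ => ?_
      ring
    · ring
  · refine iSup₂_le fun b hb => ?_
    let θ : Fin (d + 1) → ℝ := Fin.snoc (α := fun _ => ℝ)
      (fun i => b (Fin.last d) - b i.castSucc) (1 - b (Fin.last d))
    have hθ : θ ∈ cumulantDomain d := by
      refine ⟨fun i => ?_, ?_⟩
      · simp only [θ, Fin.snoc_castSucc, Fin.snoc_last]
        linarith [hb i.castSucc]
      · simpa [θ] using hb (Fin.last d)
    refine le_trans (le_of_eq ?_) (le_iSup₂ θ hθ)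
    congr 1
    rw [Fin.sum_univ_castSucc]
    simp only [θ, Fin.snoc_castSucc, Fin.snoc_last, weights_castSucc, weights_last]
    rw [add_assoc]
    congr 1
    · refine Finset.sum_congr rfl fun i _ => ?_
      rw [show 1 - (b (Fin.last d) - b i.castSucc) - (1 - b (Fin.last d)) = b i.castSucc by ring]
      ring
    · rw [sub_sub_cancel]
      ring

theorem le_conjugate {d : ℕ} (τ : Fin (d + 1) → ℝ) (x : Fin (d + 1) → ℝ) {b : Fin (d + 1) → ℝ}
    (hb : ∀ j, 0 < b j) :
    ((∑ j, (x j - b j * x j + weights τ j * Real.log (b j)) : ℝ) : EReal) ≤ conjugate τ x := by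
  rw [conjugate_eq_iSup]
  exact le_iSup₂ (f := fun (b : Fin (d + 1) → ℝ)
    (_ : b ∈ {b : Fin (d + 1) → ℝ | ∀ j, 0 < b j}) =>
      ((∑ j, (x j - b j * x j + weights τ j * Real.log (b j)) : ℝ) : EReal)) b hb

/-- Let ε decrease to 0 in b + ε. The boundary case b_j = 0 is needed because the optimal b_j = w_j
/ x_j vanishes when w_j = 0. -/
theorem le_conjugate_of_nonneg {d : ℕ} (τ : Fin (d + 1) → ℝ) (x : Fin (d + 1) → ℝ)
    {b : Fin (d + 1) → ℝ} (hb : ∀ j, 0 < b j ∨ (weights τ j = 0 ∧ b j = 0)) :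
    ((∑ j, (x j - b j * x j + weights τ j * Real.log (b j)) : ℝ) : EReal) ≤ conjugate τ x := by
  have hlim : Tendsto (fun ε : ℝ => ((∑ j, (x j - (b j + ε) * x j
      + weights τ j * Real.log (b j + ε)) : ℝ) : EReal)) (𝓝[>] 0)
      (𝓝 ((∑ j, (x j - b j * x j + weights τ j * Real.log (b j)) : ℝ) : EReal)) := by
    refine (continuous_coe_real_ereal.tendsto _).comp (tendsto_finsetSum _ fun j _ => ?_)
    have h0 : Tendsto (fun ε : ℝ => b j + ε) (𝓝[>] 0) (𝓝 (b j)) := by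
      have : Tendsto (fun ε : ℝ => b j + ε) (𝓝 0) (𝓝 (b j + 0)) :=
        (continuous_const.add continuous_id).tendsto 0
      rw [add_zero] at this
      exact this.mono_left nhdsWithin_le_nhds
    refine (tendsto_const_nhds.sub (h0.mul_const _)).add ?_
    rcases hb j with h | ⟨h, -⟩
    · exact (h0.log h.ne').const_mul _
    · simp [h]
  refine le_of_tendsto hlim ?_
  filter_upwards [self_mem_nhdsWithin] with ε hε
  refine le_conjugate τ x fun j => ?_
  have : 0 ≤ b j := by rcases hb j with h | ⟨-, h⟩ <;> simp [h, le_of_lt]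
  exact add_pos_of_nonneg_of_pos this hε

theorem conjugate_nonneg {d : ℕ} (τ : Fin (d + 1) → ℝ) (x : Fin (d + 1) → ℝ) :
    0 ≤ conjugate τ x := by
  simpa using le_conjugate τ x (b := fun _ => 1) (fun _ => one_pos)

theorem conjugate_eq_top {d : ℕ} {τ : Fin (d + 1) → ℝ} (hτ : StrictMono τ)
    (h1 : τ (Fin.last d) ≤ 1) {x : Fin (d + 1) → ℝ} {j : Fin (d + 1)}
    (hj : ¬ (0 < x j ∨ (weights τ j = 0 ∧ x j = 0))) : conjugate τ x = ⊤ := by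
  have ha := weights_nonneg hτ h1 j
  have hj0 : x j ≤ 0 := not_lt.1 fun h => hj (Or.inl h)
  -- Test with b = 1 except b_j = R → ∞: the term -R x_j dominates if x_j < 0, and w_j log R does if
  -- x_j = 0 < w_j.
  have hlim : Tendsto (fun R : ℝ => (x j - R * x j + weights τ j * Real.log R)
      + ∑ k ∈ Finset.univ.erase j, (x k - 1 * x k + weights τ k * Real.log 1)) atTop atTop := by
    refine tendsto_atTop_add_const_right _ _ ?_
    rcases hj0.lt_or_eq with h | h
    · refine tendsto_atTop_mono' _ ?_ (tendsto_atTop_add_const_left _ (x j)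
        (tendsto_id.atTop_mul_const (neg_pos.2 h)))
      filter_upwards [eventually_ge_atTop 1] with R hR
      have := mul_nonneg ha (Real.log_nonneg hR)
      simp only [id]
      linarith
    · have ha' : 0 < weights τ j := ha.lt_of_ne fun h' => hj (Or.inr ⟨h'.symm, h⟩)
      simpa [h] using Real.tendsto_log_atTop.const_mul_atTop ha'
  rw [EReal.eq_top_iff_forall_lt]
  intro M
  obtain ⟨R, hR, hR0⟩ := ((hlim.eventually_gt_atTop M).and (eventually_gt_atTop 0)).exists
  refine lt_of_lt_of_le (EReal.coe_lt_coe_iff.2 hR) ?_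
  refine le_trans (le_of_eq ?_) (le_conjugate τ x (b := Function.update 1 j R) fun k => ?_)
  · rw [← Finset.add_sum_erase _ _ (Finset.mem_univ j)]
    congr 2
    · simp
    · refine Finset.sum_congr rfl fun k hk => ?_
      simp [Function.update_of_ne (Finset.ne_of_mem_erase hk)]
  · by_cases hk : k = j
    · subst hk; simpa using hR0
    · simp [Function.update_of_ne hk]

theorem fenchel_le {a x b : ℝ} (ha : 0 ≤ a) (hx : 0 < x ∨ (a = 0 ∧ x = 0)) (hb : 0 < b) :
    x - b * x + a * Real.log b ≤ x - a + a * Real.log (a / x) := by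
  rcases ha.eq_or_lt with rfl | ha
  · have : 0 ≤ x := by rcases hx with h | ⟨-, h⟩ <;> linarith
    have := mul_nonneg hb.le this
    simp
    linarith
  · have hx : 0 < x := by
      rcases hx with h | ⟨h, -⟩
      · exact h
      · exact absurd h ha.ne'
    -- The inequality log u ≤ u - 1 at u = b x / a, which is sharp at the optimum b = a / x.
    have h := Real.log_le_sub_one_of_pos (show 0 < b * (x / a) by positivity)
    rw [Real.log_mul hb.ne' (by positivity), Real.log_div hx.ne' ha.ne'] at h
    rw [Real.log_div ha.ne' hx.ne']
    have h' := mul_le_mul_of_nonneg_left h ha.le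
    have : a * (b * (x / a) - 1) = b * x - a := by field_simp
    rw [this] at h'
    linarith

theorem explicitRate_eq_sum {d : ℕ} (τ : Fin (d + 1) → ℝ) (y : Fin d → ℝ) :
    explicitRate τ y = ∑ j, logTerm (weights τ j) (completion y j) := by
  rw [Fin.sum_univ_castSucc]
  simp [explicitRate]

theorem logTerm_ne_bot (a x : ℝ) : logTerm a x ≠ ⊥ := by
  unfold logTerm
  split_ifs
  · exact EReal.coe_ne_bot _
  · simp

theorem coe_finset_sum {ι : Type*} (s : Finset ι) (f : ι → ℝ) :
    ((∑ i ∈ s, f i : ℝ) : EReal) = ∑ i ∈ s, (f i : EReal) := by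
  classical
  induction s using Finset.induction_on with
  | empty => simp
  | insert i s hi ih => rw [Finset.sum_insert hi, Finset.sum_insert hi, EReal.coe_add, ih]

theorem sum_ne_bot {ι : Type*} (s : Finset ι) (f : ι → EReal) (hf : ∀ i, f i ≠ ⊥) :
    ∑ i ∈ s, f i ≠ ⊥ := by
  classical
  induction s using Finset.induction_on with
  | empty => simp
  | insert i s hi ih =>
    rw [Finset.sum_insert hi, Ne, EReal.add_eq_bot_iff]
    exact fun h => h.elim (hf i) ih

theorem explicitRate_eq_coe {d : ℕ} {τ : Fin (d + 1) → ℝ} {y : Fin d → ℝ}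
    (hy : ∀ j, 0 < completion y j ∨ (weights τ j = 0 ∧ completion y j = 0)) :
    explicitRate τ y =
      ((∑ j, weights τ j * Real.log (weights τ j / completion y j) : ℝ) : EReal) := by
  rw [explicitRate_eq_sum, coe_finset_sum]
  exact Finset.sum_congr rfl fun j _ => if_pos (hy j)

theorem explicitRate_eq_top {d : ℕ} {τ : Fin (d + 1) → ℝ} {y : Fin d → ℝ} {j : Fin (d + 1)}
    (hj : ¬ (0 < completion y j ∨ (weights τ j = 0 ∧ completion y j = 0))) :
    explicitRate τ y = ⊤ := by
  rw [explicitRate_eq_sum, ← Finset.add_sum_erase _ _ (Finset.mem_univ j), logTerm, if_neg hj]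
  exact EReal.top_add_of_ne_bot (sum_ne_bot _ _ fun i => logTerm_ne_bot _ _)

theorem conjugate_completion_le {d : ℕ} {τ : Fin (d + 1) → ℝ} (hτ0 : τ 0 = 0) (hτ : StrictMono τ)
    (h1 : τ (Fin.last d) ≤ 1) (y : Fin d → ℝ) :
    conjugate τ (completion y) ≤ explicitRate τ y := by
  by_cases hy : ∀ j, 0 < completion y j ∨ (weights τ j = 0 ∧ completion y j = 0)
  · rw [explicitRate_eq_coe hy, conjugate_eq_iSup]
    refine iSup₂_le fun b hb => EReal.coe_le_coe_iff.2 ?_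
    refine (Finset.sum_le_sum fun j _ =>
      fenchel_le (weights_nonneg hτ h1 j) (hy j) (hb j)).trans (le_of_eq ?_)
    rw [Finset.sum_add_distrib, Finset.sum_sub_distrib, sum_completion, sum_weights hτ0]
    ring
  · push Not at hy
    obtain ⟨j, hj⟩ := hy
    rw [explicitRate_eq_top (j := j) (by push Not; exact hj)]
    exact le_top

theorem explicitRate_le_conjugate {d : ℕ} {τ : Fin (d + 1) → ℝ} (hτ0 : τ 0 = 0)
    (hτ : StrictMono τ) (h1 : τ (Fin.last d) ≤ 1) {y : Fin d → ℝ} {x : Fin (d + 1) → ℝ}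
    (hx : ∑ k, x k ≠ 0) (hxy : normalize x = y) :
    explicitRate τ y ≤ conjugate τ x := by
  by_cases hg : ∀ j, 0 < x j ∨ (weights τ j = 0 ∧ x j = 0)
  swap
  · push Not at hg
    obtain ⟨j, hj⟩ := hg
    rw [conjugate_eq_top hτ h1 (j := j) (by push Not; exact hj)]
    exact le_top
  set s := ∑ k, x k with hs
  have hx0 : ∀ j, 0 ≤ x j := fun j => by rcases hg j with h | ⟨-, h⟩ <;> simp [h, le_of_lt]
  have hs0 : 0 < s := (Finset.sum_nonneg fun j _ => hx0 j).lt_of_ne hx.symm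
  have hz : ∀ j, completion y j = x j / s := by
    intro j
    induction j using Fin.lastCases with
    | cast i => rw [completion_castSucc, ← hxy]; rfl
    | last =>
      rw [completion_last, ← hxy, eq_div_iff hx]
      simp only [normalize]
      rw [← Finset.sum_div, ← hs, sub_mul, div_mul_cancel₀ _ hx, hs, Fin.sum_univ_castSucc]
      ring
  have hgz : ∀ j, 0 < completion y j ∨ (weights τ j = 0 ∧ completion y j = 0) := by
    intro j
    rw [hz]
    rcases hg j with h | ⟨h, h'⟩
    · exact Or.inl (div_pos h hs0)
    · exact Or.inr ⟨h, by simp [h']⟩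
  rw [explicitRate_eq_coe hgz]
  refine le_trans (EReal.coe_le_coe_iff.2 ?_) (le_conjugate_of_nonneg τ x
    (b := fun j => weights τ j / x j) fun j => ?_)
  · have key : ∀ j, x j - weights τ j / x j * x j + weights τ j * Real.log (weights τ j / x j)
        = x j - weights τ j - weights τ j * Real.log s
          + weights τ j * Real.log (weights τ j / completion y j) := by
      intro j
      rcases (weights_nonneg hτ h1 j).eq_or_lt with h | h
      · simp [← h]
      · have hxj : 0 < x j := (hg j).resolve_right fun h' => h.ne' h'.1
        rw [hz, div_mul_cancel₀ _ hxj.ne', Real.log_div h.ne' hxj.ne',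
          Real.log_div h.ne' (div_pos hxj hs0).ne', Real.log_div hxj.ne' hs0.ne']
        ring
    rw [Finset.sum_congr rfl fun j _ => key j, Finset.sum_add_distrib, Finset.sum_sub_distrib,
      Finset.sum_sub_distrib, ← Finset.sum_mul, sum_weights hτ0, ← hs]
    -- What remains is 0 ≤ s - 1 - log s, the cost of leaving the simplex along a ray.
    linarith [Real.log_le_sub_one_of_pos hs0]
  · rcases (weights_nonneg hτ h1 j).eq_or_lt with h | h
    · exact Or.inr ⟨h.symm, by simp [← h]⟩
    · exact Or.inl (div_pos h ((hg j).resolve_right fun h' => h.ne' h'.1))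

theorem normalize_completion {d : ℕ} (y : Fin d → ℝ) : normalize (completion y) = y := by
  ext i
  simp [normalize, sum_completion]

theorem conjugate_completion {d : ℕ} {τ : Fin (d + 1) → ℝ} (hτ0 : τ 0 = 0) (hτ : StrictMono τ)
    (h1 : τ (Fin.last d) ≤ 1) (y : Fin d → ℝ) :
    conjugate τ (completion y) = explicitRate τ y :=
  le_antisymm (conjugate_completion_le hτ0 hτ h1 y)
    (explicitRate_le_conjugate hτ0 hτ h1 (by simp [sum_completion]) (normalize_completion y))

theorem contractedRate_eq_explicitRate {d : ℕ} {τ : Fin (d + 1) → ℝ} (hτ0 : τ 0 = 0)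
    (hτ : StrictMono τ) (h1 : τ (Fin.last d) ≤ 1) (y : Fin d → ℝ) :
    contractedRate τ y = explicitRate τ y := by
  apply le_antisymm
  · rw [← conjugate_completion hτ0 hτ h1]
    exact iInf₂_le (completion y) ⟨by simp [sum_completion], normalize_completion y⟩
  · exact le_iInf₂ fun x hx => explicitRate_le_conjugate hτ0 hτ h1 hx.1 hx.2

/-! ### Goodness of the rate function -/

/-- The set of `y` with nonnegative coordinates whose sum is at most one. -/
def subSimplex (d : ℕ) : Set (Fin d → ℝ) := {y | (∀ i, 0 ≤ y i) ∧ ∑ l, y l ≤ 1}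

theorem isCompact_subSimplex (d : ℕ) : IsCompact (subSimplex d) := by
  refine (isCompact_Icc (a := (0 : Fin d → ℝ)) (b := 1)).of_isClosed_subset ?_ ?_
  · refine IsClosed.inter ?_ (isClosed_le (f := fun y : Fin d → ℝ => ∑ l, y l)
      (continuous_finsetSum _ fun l _ => continuous_apply l) continuous_const)
    have : {y : Fin d → ℝ | ∀ i, 0 ≤ y i} = Ici 0 := by ext y; simp [Pi.le_def]
    exact (this ▸ isClosed_Ici : IsClosed {y : Fin d → ℝ | ∀ i, 0 ≤ y i})
  · intro y hy
    exact ⟨fun i => hy.1 i, fun i =>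
      (Finset.single_le_sum (fun l _ => hy.1 l) (Finset.mem_univ i)).trans hy.2⟩

theorem isGoodRateFunction_explicitRate {d : ℕ} {τ : Fin (d + 1) → ℝ} (hτ0 : τ 0 = 0)
    (hτ : StrictMono τ) (h1 : τ (Fin.last d) ≤ 1) : IsGoodRateFunction (explicitRate τ) := by
  have hlsc : LowerSemicontinuous (explicitRate τ) := by
    have : explicitRate τ = fun y => conjugate τ (completion y) :=
      funext fun y => (conjugate_completion hτ0 hτ h1 y).symm
    rw [this]
    -- For fixed b the expression is affine in y, so the supremum is lower semicontinuous.
    simp only [conjugate_eq_iSup]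
    refine lowerSemicontinuous_biSup fun b _ => Continuous.lowerSemicontinuous ?_
    have hc := continuous_completion (d := d)
    refine continuous_coe_real_ereal.comp (continuous_finsetSum _ fun j _ => ?_)
    have := (continuous_apply j).comp hc
    exact (this.sub (continuous_const.mul this)).add continuous_const
  refine ⟨fun y => ?_, hlsc, fun a _ => ?_⟩
  · rw [← conjugate_completion hτ0 hτ h1]
    exact conjugate_nonneg _ _
  · refine (isCompact_subSimplex d).of_isClosed_subset (hlsc.isClosed_preimage (a : EReal)) ?_
    intro y hy
    have hg : ∀ j, 0 ≤ completion y j := by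
      intro j
      by_contra hj
      have : explicitRate τ y = ⊤ := explicitRate_eq_top (j := j) (by
        rintro (h | ⟨-, h⟩)
        · exact hj h.le
        · exact hj h.ge)
      simp [this] at hy
    exact ⟨fun i => by simpa using hg i.castSucc, by simpa using hg (Fin.last d)⟩

/-! ### Stirling asymptotics of multinomial coefficients -/

theorem tendsto_log_factorial_sub_div :
    Tendsto (fun n : ℕ => (Real.log n.factorial - (n * Real.log n - n)) / n) atTop (𝓝 0) := by
  -- The Stirling ratio n! / (√(2n) (n/e)^n) has a positive limit, so its logarithm is bounded and
  -- the error is (1/2) log (2n) + O(1).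
  have h1 : Tendsto (fun n : ℕ => Real.log (Stirling.stirlingSeq n) / n) atTop (𝓝 0) :=
    (Stirling.tendsto_stirlingSeq_sqrt_pi.log (by positivity)).div_atTop
      tendsto_natCast_atTop_atTop
  have h2 : Tendsto (fun n : ℕ => 1 / 2 * Real.log 2 / n) atTop (𝓝 0) :=
    tendsto_const_nhds.div_atTop tendsto_natCast_atTop_atTop
  have h3 : Tendsto (fun n : ℕ => 1 / 2 * (Real.log n / n)) atTop (𝓝 (1 / 2 * 0)) :=
    ((Real.isLittleO_log_id_atTop.tendsto_div_nhds_zero).comp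
      tendsto_natCast_atTop_atTop).const_mul _
  have h := (h1.add h2).add h3
  rw [mul_zero, add_zero, add_zero] at h
  refine h.congr' ?_
  filter_upwards [eventually_gt_atTop 0] with n hn
  have hn' : (0 : ℝ) < n := by exact_mod_cast hn
  rw [Stirling.log_stirlingSeq_formula, Real.log_div hn'.ne' (Real.exp_pos 1).ne', Real.log_exp,
    Real.log_mul two_ne_zero hn'.ne']
  field_simp
  ring

/-- For a > 0 one has m → ∞, so the previous limit along m is multiplied by m / n → a. For a = 0
this argument is unavailable, whence the requirement that m vanish. -/
theorem tendsto_log_factorial_sub_div_of_tendsto {m : ℕ → ℕ} {a : ℝ} (ha : 0 ≤ a)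
    (hm : Tendsto (fun n : ℕ => (m n : ℝ) / n) atTop (𝓝 a)) (h0 : a = 0 → ∀ n, m n = 0) :
    Tendsto (fun n : ℕ => (Real.log (m n).factorial - (m n * Real.log (m n) - m n)) / n)
      atTop (𝓝 0) := by
  rcases ha.eq_or_lt with rfl | ha
  · simp [h0 rfl]
  have hmt : Tendsto m atTop atTop := by
    rw [← tendsto_natCast_atTop_iff (R := ℝ)]
    refine (hm.pos_mul_atTop ha tendsto_natCast_atTop_atTop).congr' ?_
    filter_upwards [eventually_gt_atTop 0] with n hn
    exact div_mul_cancel₀ _ (by positivity)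
  have := (tendsto_log_factorial_sub_div.comp hmt).mul hm
  rw [zero_mul] at this
  refine this.congr' ?_
  filter_upwards [hmt.eventually_gt_atTop 0] with n hn
  exact div_mul_div_cancel₀ (by positivity)

/-- Multinomial coefficients weighted by powers decay exponentially with rate the relative
entropy. -/
theorem tendsto_log_multinomial_mul_prod_div {ι : Type*} [Fintype ι] {a z : ι → ℝ} {m : ℕ → ι → ℕ}
    {N : ℕ → ℕ} (ha : ∀ j, 0 ≤ a j)
    (hm : ∀ j, Tendsto (fun n : ℕ => (m n j : ℝ) / n) atTop (𝓝 (a j)))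
    (h0 : ∀ j, a j = 0 → ∀ n, m n j = 0) (hsum : ∀ n, ∑ j, m n j = n)
    (hN : ∀ n, N n * ∏ j, (m n j).factorial = n.factorial)
    (hz : ∀ j, 0 < z j ∨ (a j = 0 ∧ z j = 0)) :
    Tendsto (fun n : ℕ => Real.log (N n * ∏ j, z j ^ m n j) / n) atTop
      (𝓝 (-∑ j, a j * Real.log (a j / z j))) := by
  have hlim : Tendsto (fun n : ℕ => (Real.log n.factorial - (n * Real.log n - n)) / n
      - ∑ j, (Real.log (m n j).factorial - (m n j * Real.log (m n j) - m n j)) / n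
      - ∑ j, ((m n j : ℝ) / n * Real.log ((m n j : ℝ) / n) - (m n j : ℝ) / n * Real.log (z j)))
      -- Stirling errors vanish after division by n, and the terms linear in m_j cancel because ∑
      -- m_j = n; only the entropy of m / n against z survives.
      atTop (𝓝 (0 - ∑ j : ι, 0 - ∑ j, (a j * Real.log (a j) - a j * Real.log (z j)))) := by
    refine (tendsto_log_factorial_sub_div.sub (tendsto_finsetSum _ fun j _ =>
      tendsto_log_factorial_sub_div_of_tendsto (ha j) (hm j) (h0 j))).sub
      (tendsto_finsetSum _ fun j _ => ?_)
    exact ((Real.continuous_mul_log.tendsto _).comp (hm j)).sub ((hm j).mul_const _)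
  have hval : 0 - ∑ j : ι, (0 : ℝ) - ∑ j, (a j * Real.log (a j) - a j * Real.log (z j))
      = -∑ j, a j * Real.log (a j / z j) := by
    simp only [Finset.sum_const_zero, sub_self, zero_sub]
    congr 1
    refine Finset.sum_congr rfl fun j _ => ?_
    rcases (ha j).eq_or_lt with h | h
    · simp [← h]
    · rw [Real.log_div h.ne' ((hz j).resolve_right fun h' => h.ne' h'.1).ne']
      ring
  rw [hval] at hlim
  refine hlim.congr' ?_
  filter_upwards [eventually_gt_atTop 0] with n hn
  have hn' : (0 : ℝ) < n := by exact_mod_cast hn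
  have hfac : ∀ k : ℕ, (k.factorial : ℝ) ≠ 0 := fun k => by positivity
  have hNr : (N n : ℝ) * ∏ j, ((m n j).factorial : ℝ) = n.factorial := by exact_mod_cast hN n
  have hN0 : (N n : ℝ) ≠ 0 := fun h => hfac n (by rw [← hNr, h, zero_mul])
  have hpow : ∀ j ∈ Finset.univ, z j ^ m n j ≠ 0 := by
    intro j _
    rcases hz j with h | ⟨h, -⟩
    · positivity
    · simp [h0 j h n]
  have hlogN : Real.log (N n) = Real.log n.factorial - ∑ j, Real.log (m n j).factorial := by
    rw [← hNr, Real.log_mul hN0 (Finset.prod_ne_zero_iff.2 fun j _ => hfac _),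
      Real.log_prod fun j _ => hfac _]
    ring
  rw [Real.log_mul hN0 (Finset.prod_ne_zero_iff.2 hpow), Real.log_prod hpow, hlogN]
  have hterm : ∀ j, ((Real.log (m n j).factorial - (m n j * Real.log (m n j) - m n j)) / n
      + ((m n j : ℝ) / n * Real.log ((m n j : ℝ) / n) - (m n j : ℝ) / n * Real.log (z j)))
      = Real.log (m n j).factorial / n - (m n j : ℝ) * ((Real.log n - 1) / n)
        - Real.log (z j ^ m n j) / n := by
    intro j
    rw [Real.log_pow]
    rcases Nat.eq_zero_or_pos (m n j) with h | h
    · simp [h]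
    · rw [Real.log_div (by positivity) hn'.ne']
      ring
  rw [sub_sub, ← Finset.sum_add_distrib, Finset.sum_congr rfl fun j _ => hterm j,
    Finset.sum_sub_distrib, Finset.sum_sub_distrib, ← Finset.sum_mul, ← Finset.sum_div,
    ← Finset.sum_div, ← Nat.cast_sum, hsum]
  field_simp
  ring

/-! ### Assignments of sample points to cells -/

/-- The functions `f ∘ σ`, where `σ` is a permutation. -/
def rearrangements {n : ℕ} {ι : Type*} [DecidableEq ι] (f : Fin n → ι) : Finset (Fin n → ι) :=
  Finset.univ.image fun σ : Equiv.Perm (Fin n) => f ∘ σ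

/-- Orbit–stabilizer: the permutations with a given value f ∘ σ form the coset of σ under the
stabilizer of f, of order ∏ m_j!. -/
theorem card_rearrangements_mul {n : ℕ} {ι : Type*} [DecidableEq ι] [Fintype ι] (f : Fin n → ι) :
    (rearrangements f).card * ∏ j, (Fintype.card {i // f i = j}).factorial = n.factorial := by
  have h := Finset.card_eq_sum_card_image (fun σ : Equiv.Perm (Fin n) => f ∘ σ) Finset.univ
  rw [Finset.card_univ, Fintype.card_perm, Fintype.card_fin] at h
  rw [h, ← smul_eq_mul, ← Finset.sum_const]
  refine Finset.sum_congr rfl fun g hg => ?_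
  obtain ⟨σ, -, rfl⟩ := Finset.mem_image.1 hg
  rw [← DomMulAct.stabilizer_card f, Fintype.card_subtype]
  refine Finset.card_bij (fun π _ => π * σ) ?_ ?_ ?_
  · intro π hπ
    simp only [Finset.mem_filter, Finset.mem_univ, true_and] at hπ ⊢
    rw [Equiv.Perm.coe_mul, ← Function.comp_assoc, hπ]
  · intro π _ ρ _ h
    exact mul_right_cancel h
  · intro π hπ
    simp only [Finset.mem_filter, Finset.mem_univ, true_and] at hπ
    refine ⟨π * σ⁻¹, ?_, by simp⟩
    simp only [Finset.mem_filter, Finset.mem_univ, true_and]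
    rw [Equiv.Perm.coe_mul, ← Function.comp_assoc, hπ, Function.comp_assoc, ← Equiv.Perm.coe_mul]
    simp

/-- The largest `j` such that `κ j ≤ i`. -/
noncomputable def cellIndex {d : ℕ} (κ : Fin (d + 1) → ℕ) (i : ℕ) : Fin (d + 1) :=
  (Finset.univ.filter fun j => κ j ≤ i).sup id

/-- A Galois connection between κ and its cell index; κ 0 = 0 makes the defining set nonempty. Ties
in κ merely give empty cells. -/
theorem le_cellIndex {d : ℕ} {κ : Fin (d + 1) → ℕ} (hκ : Monotone κ) (h0 : κ 0 = 0) {i : ℕ}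
    {j : Fin (d + 1)} : j ≤ cellIndex κ i ↔ κ j ≤ i := by
  constructor
  · intro h
    obtain ⟨k, hk, hk'⟩ := Finset.exists_mem_eq_sup (Finset.univ.filter fun j => κ j ≤ i)
      ⟨0, by simp [h0]⟩ id
    rw [cellIndex, hk'] at h
    exact (hκ h).trans (Finset.mem_filter.1 hk).2
  · intro h
    exact Finset.le_sup (f := id) (Finset.mem_filter.2 ⟨Finset.mem_univ _, h⟩)

theorem monotone_cellIndex {d : ℕ} {κ : Fin (d + 1) → ℕ} (hκ : Monotone κ) (h0 : κ 0 = 0) :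
    Monotone (cellIndex κ) := fun _ _ h =>
  (le_cellIndex hκ h0).2 (((le_cellIndex hκ h0).1 le_rfl).trans h)

theorem cellIndex_eq_castSucc_iff {d : ℕ} {κ : Fin (d + 1) → ℕ} (hκ : Monotone κ) (h0 : κ 0 = 0)
    {i : ℕ} {l : Fin d} : cellIndex κ i = l.castSucc ↔ κ l.castSucc ≤ i ∧ i < κ l.succ := by
  rw [← le_cellIndex hκ h0, ← not_le, ← le_cellIndex hκ h0, not_le, Fin.lt_def, Fin.le_def,
    Fin.ext_iff, Fin.val_succ, Fin.val_castSucc]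
  omega

theorem cellIndex_eq_last_iff {d : ℕ} {κ : Fin (d + 1) → ℕ} (hκ : Monotone κ) (h0 : κ 0 = 0)
    {i : ℕ} : cellIndex κ i = Fin.last d ↔ κ (Fin.last d) ≤ i := by
  rw [← le_cellIndex hκ h0, Fin.last_le_iff]

theorem card_fin_subtype {n a b : ℕ} (hb : b ≤ n) (p : Fin n → Prop) [DecidablePred p]
    (hp : ∀ i, p i ↔ a ≤ (i : ℕ) ∧ (i : ℕ) < b) : Fintype.card {i // p i} = b - a := by
  rw [Fintype.card_subtype, ← Nat.card_Ico, ← Finset.card_map Fin.valEmbedding]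
  congr 1
  ext i
  simp only [Finset.mem_map, Finset.mem_filter, Finset.mem_univ, true_and, Finset.mem_Ico, hp,
    Fin.valEmbedding_apply]
  exact ⟨by rintro ⟨k, hk, rfl⟩; exact hk, fun h => ⟨⟨i, h.2.trans_le hb⟩, h, rfl⟩⟩

theorem card_cellIndex_castSucc {n d : ℕ} {κ : Fin (d + 1) → ℕ} (hκ : Monotone κ) (h0 : κ 0 = 0)
    (hn : κ (Fin.last d) ≤ n) (l : Fin d) :
    Fintype.card {i : Fin n // cellIndex κ i = l.castSucc} = κ l.succ - κ l.castSucc :=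
  card_fin_subtype ((hκ (Fin.le_last _)).trans hn) _ fun _ => cellIndex_eq_castSucc_iff hκ h0

theorem card_cellIndex_last {n d : ℕ} {κ : Fin (d + 1) → ℕ} (hκ : Monotone κ) (h0 : κ 0 = 0) :
    Fintype.card {i : Fin n // cellIndex κ i = Fin.last d} = n - κ (Fin.last d) :=
  card_fin_subtype le_rfl _ fun i => by
    rw [cellIndex_eq_last_iff hκ h0]
    exact ⟨fun h => ⟨h, i.2⟩, fun h => h.1⟩

/-- The ranks `⌊n τ_j⌋`. -/
noncomputable def ranks {d : ℕ} (τ : Fin (d + 1) → ℝ) (n : ℕ) (j : Fin (d + 1)) : ℕ :=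
  ⌊(n : ℝ) * τ j⌋₊

/-- The cell of the `i`-th smallest sample point. -/
noncomputable def cellMap {d : ℕ} (τ : Fin (d + 1) → ℝ) (n : ℕ) (i : Fin n) : Fin (d + 1) :=
  cellIndex (ranks τ n) i

/-- The number of sample points in each cell. -/
noncomputable def cellCard {d : ℕ} (τ : Fin (d + 1) → ℝ) (n : ℕ) (j : Fin (d + 1)) : ℕ :=
  Fintype.card {i : Fin n // cellMap τ n i = j}

section

variable {d : ℕ} {τ : Fin (d + 1) → ℝ}

theorem monotone_ranks (hτ : StrictMono τ) (n : ℕ) : Monotone (ranks τ n) := fun _ _ h =>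
  Nat.floor_mono (mul_le_mul_of_nonneg_left (hτ.monotone h) n.cast_nonneg)

theorem ranks_zero (hτ0 : τ 0 = 0) (n : ℕ) : ranks τ n 0 = 0 := by simp [ranks, hτ0]

theorem ranks_le (hτ : StrictMono τ) (h1 : τ (Fin.last d) ≤ 1) (n : ℕ) (j : Fin (d + 1)) :
    ranks τ n j ≤ n := by
  refine Nat.floor_le_of_le ?_
  exact mul_le_of_le_one_right n.cast_nonneg ((hτ.monotone (Fin.le_last j)).trans h1)

theorem tendsto_ranks_div (hτ0 : τ 0 = 0) (hτ : StrictMono τ) (j : Fin (d + 1)) :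
    Tendsto (fun n : ℕ => (ranks τ n j : ℝ) / n) atTop (𝓝 (τ j)) := by
  have h0 : 0 ≤ τ j := hτ0 ▸ hτ.monotone (Fin.zero_le j)
  refine ((tendsto_nat_floor_mul_div_atTop h0).comp tendsto_natCast_atTop_atTop).congr fun n => ?_
  simp [ranks, mul_comm]

theorem tendsto_cellCard_div (hτ0 : τ 0 = 0) (hτ : StrictMono τ) (h1 : τ (Fin.last d) ≤ 1)
    (j : Fin (d + 1)) :
    Tendsto (fun n : ℕ => (cellCard τ n j : ℝ) / n) atTop (𝓝 (weights τ j)) := by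
  induction j using Fin.lastCases with
  | last =>
    rw [weights_last]
    refine (tendsto_const_nhds.sub (tendsto_ranks_div hτ0 hτ (Fin.last d))).congr' ?_
    filter_upwards [eventually_gt_atTop 0] with n hn
    have hn' : (n : ℝ) ≠ 0 := by positivity
    rw [cellCard, show Fintype.card {i : Fin n // cellMap τ n i = Fin.last d} = _ from
      card_cellIndex_last (monotone_ranks hτ n) (ranks_zero hτ0 n),
      Nat.cast_sub (ranks_le hτ h1 n _), sub_div, div_self hn']
  | cast l =>
    rw [weights_castSucc]
    refine ((tendsto_ranks_div hτ0 hτ l.succ).sub (tendsto_ranks_div hτ0 hτ l.castSucc)).congr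
      fun n => ?_
    rw [cellCard, show Fintype.card {i : Fin n // cellMap τ n i = l.castSucc} = _ from
      card_cellIndex_castSucc (monotone_ranks hτ n) (ranks_zero hτ0 n) (ranks_le hτ h1 n _) l,
      Nat.cast_sub (monotone_ranks hτ n (Fin.castSucc_le_succ l)), sub_div]

/-- Only the last weight can vanish, when τ_d = 1; then ⌊n τ_d⌋ = n and the cell is exactly empty.
Exactness matters, since z_{d+1} may then be 0 and its power must be 0 ^ 0 = 1. -/
theorem cellCard_eq_zero (hτ0 : τ 0 = 0) (hτ : StrictMono τ) (j : Fin (d + 1))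
    (hj : weights τ j = 0) (n : ℕ) : cellCard τ n j = 0 := by
  induction j using Fin.lastCases with
  | cast l => exact absurd hj (weights_castSucc_pos hτ l).ne'
  | last =>
    rw [weights_last, sub_eq_zero] at hj
    rw [cellCard, show Fintype.card {i : Fin n // cellMap τ n i = Fin.last d} = _ from
      card_cellIndex_last (monotone_ranks hτ n) (ranks_zero hτ0 n)]
    simp [ranks, ← hj]

theorem sum_cellCard (τ : Fin (d + 1) → ℝ) (n : ℕ) : ∑ j, cellCard τ n j = n := by
  have := Finset.card_eq_sum_card_fiberwise (f := cellMap τ n) (s := Finset.univ)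
    (t := Finset.univ) (fun _ _ => Finset.mem_coe.2 (Finset.mem_univ _))
  rw [Finset.card_univ, Fintype.card_fin] at this
  conv_rhs => rw [this]
  exact Finset.sum_congr rfl fun j _ => Fintype.card_subtype _

theorem tendsto_log_card_rearrangements_mul (hτ0 : τ 0 = 0) (hτ : StrictMono τ)
    (h1 : τ (Fin.last d) ≤ 1) {z : Fin (d + 1) → ℝ}
    (hz : ∀ j, 0 < z j ∨ (weights τ j = 0 ∧ z j = 0)) :
    Tendsto (fun n : ℕ => Real.log ((rearrangements (cellMap τ n)).card
      * ∏ j, z j ^ cellCard τ n j) / n) atTop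
      (𝓝 (-∑ j, weights τ j * Real.log (weights τ j / z j))) :=
  tendsto_log_multinomial_mul_prod_div (weights_nonneg hτ h1) (tendsto_cellCard_div hτ0 hτ h1)
    (cellCard_eq_zero hτ0 hτ) (sum_cellCard τ) (fun _ => card_rearrangements_mul _) hz

theorem card_rearrangements_mul_prod_pos (hτ0 : τ 0 = 0) (hτ : StrictMono τ)
    {z : Fin (d + 1) → ℝ} (hz : ∀ j, 0 < z j ∨ (weights τ j = 0 ∧ z j = 0)) (n : ℕ) :
    0 < ((rearrangements (cellMap τ n)).card : ℝ) * ∏ j, z j ^ cellCard τ n j := by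
  refine mul_pos ?_ (Finset.prod_pos fun j _ => ?_)
  · exact_mod_cast Finset.card_pos.2 (Finset.univ_nonempty.image _)
  · rcases hz j with h | ⟨h, -⟩
    · positivity
    · simp [cellCard_eq_zero hτ0 hτ j h n]

end

/-! ### Deterministic link between order statistics and assignments -/

theorem orderStat_zero {n : ℕ} (x : Fin n → ℝ) : orderStat x 0 = 0 := by simp [orderStat]

theorem orderStat_succ {n : ℕ} (x : Fin n → ℝ) (k : Fin n) :
    orderStat x (k + 1) = x (Tuple.sort x k) := by
  have : 0 < (k : ℕ) + 1 ∧ (k : ℕ) + 1 ≤ n := ⟨by omega, k.2⟩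
  rw [orderStat, dif_pos this]
  rfl

theorem sort_le_sort {n : ℕ} (x : Fin n → ℝ) {k l : Fin n} (h : k ≤ l) :
    x (Tuple.sort x k) ≤ x (Tuple.sort x l) := Tuple.monotone_sort x h

/-- Order statistics count from 1 and `Tuple.sort` from 0, so the right side is T_(k+1).
Nonnegativity of the sample is for T_(0) = 0. -/
theorem orderStat_le_of_le {n : ℕ} {x : Fin n → ℝ} (hx : ∀ i, 0 ≤ x i) {r : ℕ} {k : Fin n}
    (hr : r ≤ k) : orderStat x r ≤ x (Tuple.sort x k) := by
  rcases r with - | r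
  · rw [orderStat_zero]
    exact hx _
  · rw [orderStat_succ x ⟨r, by omega⟩]
    exact sort_le_sort x (Fin.le_def.2 (Nat.le_of_succ_le hr))

theorem le_orderStat_of_lt {n : ℕ} {x : Fin n → ℝ} {r : ℕ} {k : Fin n}
    (hr : k < r) (hn : r ≤ n) : x (Tuple.sort x k) ≤ orderStat x r := by
  rcases r with - | r
  · omega
  · rw [orderStat_succ x ⟨r, by omega⟩]
    exact sort_le_sort x (Fin.le_def.2 (Nat.le_of_lt_succ hr))

theorem orderStat_mono {n : ℕ} {x : Fin n → ℝ} (hx : ∀ i, 0 ≤ x i) {r s : ℕ} (h : r ≤ s)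
    (hs : s ≤ n) : orderStat x r ≤ orderStat x s := by
  rcases h.eq_or_lt with rfl | h
  · exact le_rfl
  · exact (orderStat_le_of_le hx (k := ⟨r, by omega⟩) le_rfl).trans (le_orderStat_of_lt h hs)

theorem orderStat_le_one {n : ℕ} {x : Fin n → ℝ} (hx : ∀ i, x i ≤ 1) (r : ℕ) :
    orderStat x r ≤ 1 := by
  unfold orderStat
  split_ifs
  · exact hx _
  · exact zero_le_one

section

variable {d n : ℕ} {τ : Fin (d + 1) → ℝ}

theorem increments_apply (x : Fin n → ℝ) (l : Fin d) : increments τ x l =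
    orderStat x (ranks τ n l.succ) - orderStat x (ranks τ n l.castSucc) := rfl

theorem sum_Iio_completion_increments (hτ0 : τ 0 = 0) (x : Fin n → ℝ) (j : Fin (d + 1)) :
    ∑ k ∈ Finset.Iio j, completion (increments τ x) k = orderStat x (ranks τ n j) := by
  rw [sum_Iio_eq_sub (fun j => orderStat x (ranks τ n j)) _
    (fun l => by rw [completion_castSucc, increments_apply]), ranks_zero hτ0, orderStat_zero,
    sub_zero]

theorem increments_mem_subSimplex (hτ0 : τ 0 = 0) (hτ : StrictMono τ)
    (h1 : τ (Fin.last d) ≤ 1) {x : Fin n → ℝ} (hx : ∀ i, x i ∈ Icc (0 : ℝ) 1) :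
    increments τ x ∈ subSimplex d := by
  refine ⟨fun l => ?_, ?_⟩
  · rw [increments_apply, sub_nonneg]
    exact orderStat_mono (fun i => (hx i).1) (monotone_ranks hτ n (Fin.castSucc_le_succ l))
      (ranks_le hτ h1 n _)
  · have h := sum_Iio_last (completion (increments τ x))
    rw [sum_completion, sum_Iio_completion_increments hτ0, completion_last] at h
    linarith [orderStat_le_one (fun i => (hx i).2) (ranks τ n (Fin.last d))]

theorem abs_sum_Iio_completion_sub_le {u v : Fin d → ℝ} {δ : ℝ} (hδ : 0 ≤ δ)
    (h : ∀ l, |u l - v l| ≤ δ) (j : Fin (d + 1)) :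
    |∑ k ∈ Finset.Iio j, completion u k - ∑ k ∈ Finset.Iio j, completion v k| ≤ (d + 1) * δ := by
  rw [← Finset.sum_sub_distrib]
  refine (Finset.abs_sum_le_sum_abs _ _).trans ?_
  -- The indices below j never include the last one, so the remainder coordinate 1 - ∑ y contributes
  -- no error.
  have : ∀ k ∈ Finset.Iio j, |completion u k - completion v k| ≤ δ := by
    intro k hk
    induction k using Fin.lastCases with
    | last => exact absurd (Finset.mem_Iio.1 hk) (Fin.le_last j).not_gt
    | cast l => simpa using h l
  refine (Finset.sum_le_card_nsmul _ _ _ this).trans ?_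
  rw [nsmul_eq_mul]
  refine mul_le_mul_of_nonneg_right ?_ hδ
  have : (Finset.Iio j).card ≤ d + 1 := (Finset.card_le_univ _).trans (by simp)
  exact_mod_cast this

/-- Give each point the cell of its rank. A point in cell j lies between the order statistics
bounding that cell, which are within (d + 1) δ of the interval ends; in the last cell the upper
bound is 1. -/
theorem exists_rearrangement_of_increments_near (hτ0 : τ 0 = 0) (hτ : StrictMono τ)
    (h1 : τ (Fin.last d) ≤ 1) {x : Fin n → ℝ} (hx : ∀ i, x i ∈ Icc (0 : ℝ) 1) {y : Fin d → ℝ}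
    {δ : ℝ} (hδ : 0 ≤ δ) (h : ∀ l, |increments τ x l - y l| ≤ δ) :
    ∃ f ∈ rearrangements (cellMap τ n), ∀ i,
      x i ∈ Icc (∑ k ∈ Finset.Iio (f i), completion y k - (d + 1) * δ)
        (∑ k ∈ Finset.Iio (f i), completion y k + completion y (f i) + (d + 1) * δ) := by
  refine ⟨cellMap τ n ∘ ((Tuple.sort x)⁻¹ : Equiv.Perm (Fin n)),
    Finset.mem_image_of_mem _ (Finset.mem_univ ((Tuple.sort x)⁻¹)), fun i => ?_⟩
  obtain ⟨k, rfl⟩ := (Tuple.sort x).surjective i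
  simp only [Function.comp_apply, show ((Tuple.sort x)⁻¹ : Equiv.Perm (Fin n)) (Tuple.sort x k) = k
    from Equiv.symm_apply_apply _ _]
  have hT := fun j => abs_le.1 (abs_sum_Iio_completion_sub_le hδ h j)
  simp only [sum_Iio_completion_increments hτ0] at hT
  have hmono := monotone_ranks hτ n
  have hr0 := ranks_zero hτ0 n
  have hpos : 0 ≤ (d + 1) * δ := by positivity
  constructor
  · have := orderStat_le_of_le (fun i => (hx i).1)
      ((le_cellIndex hmono hr0 (i := k)).1 (le_refl (cellMap τ n k)))
    linarith [(hT (cellMap τ n k)).1]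
  · rcases Fin.eq_castSucc_or_eq_last (cellMap τ n k) with ⟨l, hl⟩ | hl
    · have := le_orderStat_of_lt (x := x) ((cellIndex_eq_castSucc_iff hmono hr0).1 hl).2
        (ranks_le hτ h1 n _)
      rw [hl, ← sum_Iio_succ]
      linarith [(hT l.succ).2]
    · rw [hl, sum_Iio_last, sum_completion]
      linarith [(hx (Tuple.sort x k)).2]

theorem sum_Iio_add_le {z : Fin (d + 1) → ℝ} (hz : ∀ j, 0 ≤ z j) {i j : Fin (d + 1)} (h : i < j) :
    ∑ k ∈ Finset.Iio i, z k + z i ≤ ∑ k ∈ Finset.Iio j, z k := by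
  rw [add_comm, ← Finset.sum_insert (by simp)]
  refine Finset.sum_le_sum_of_subset_of_nonneg (fun k hk => ?_) fun k _ _ => hz k
  rcases Finset.mem_insert.1 hk with rfl | hk
  · exact Finset.mem_Iio.2 h
  · exact Finset.mem_Iio.2 ((Finset.mem_Iio.1 hk).trans h)

/-- The half-open intervals are disjoint and ordered, so sorting the points makes their labels
monotone, and a multiset of labels has only one monotone arrangement. Hence x determines f, which
gives disjointness later. -/
theorem comp_sort_eq_cellMap (hτ0 : τ 0 = 0) (hτ : StrictMono τ) {z : Fin (d + 1) → ℝ}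
    (hz : ∀ j, 0 ≤ z j) {f : Fin n → Fin (d + 1)} (hf : f ∈ rearrangements (cellMap τ n))
    {x : Fin n → ℝ} (hx : ∀ i, x i ∈ Ioc (∑ k ∈ Finset.Iio (f i), z k)
      (∑ k ∈ Finset.Iio (f i), z k + z (f i))) : f ∘ Tuple.sort x = cellMap τ n := by
  have hmono : Monotone (f ∘ Tuple.sort x) := by
    intro i j hij
    by_contra! hlt
    have h1 := sum_Iio_add_le hz hlt
    have h2 := (hx (Tuple.sort x j)).2
    have h3 := (hx (Tuple.sort x i)).1
    have h4 := sort_le_sort x hij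
    simp only [Function.comp_apply] at h1
    linarith
  obtain ⟨σ, -, rfl⟩ := Finset.mem_image.1 hf
  have hmono' : Monotone (cellMap τ n ∘ (1 : Equiv.Perm (Fin n))) := fun i j h =>
    monotone_cellIndex (monotone_ranks hτ n) (ranks_zero hτ0 n) h
  have := Tuple.unique_monotone (f := cellMap τ n) (σ := σ * Tuple.sort x) (τ := 1)
    (by rwa [Equiv.Perm.coe_mul, ← Function.comp_assoc]) hmono'
  rw [Equiv.Perm.coe_mul, ← Function.comp_assoc] at this
  exact this

theorem abs_increments_sub_lt (hτ0 : τ 0 = 0) (hτ : StrictMono τ)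
    (h1 : τ (Fin.last d) ≤ 1) {y : Fin d → ℝ} (hy : ∀ j, 0 ≤ completion y j) {δ : ℝ} (hδ : 0 < δ)
    {f : Fin n → Fin (d + 1)} (hf : f ∈ rearrangements (cellMap τ n)) {x : Fin n → ℝ}
    (hx : ∀ i, x i ∈ Ioc (∑ k ∈ Finset.Iio (f i), completion y k)
      (∑ k ∈ Finset.Iio (f i), completion y k + completion y (f i)))
    (hr : ∀ l : Fin d, ∃ i, f i = l.castSucc ∧
      ∑ k ∈ Finset.Iio (f i), completion y k + completion y (f i) - δ < x i) (l : Fin d) :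
    |increments τ x l - y l| < δ := by
  have hcell := comp_sort_eq_cellMap hτ0 hτ hy hf hx
  have hmono := monotone_ranks hτ n
  have hr0 := ranks_zero hτ0 n
  -- The last point of cell l is the order statistic of rank ⌊n τ_{l+1}⌋: it lies below the right
  -- end, and above the representative, which is within δ of that end.
  have hT : ∀ j : Fin (d + 1), orderStat x (ranks τ n j) ∈
      Ioc (∑ k ∈ Finset.Iio j, completion y k - δ) (∑ k ∈ Finset.Iio j, completion y k) := by
    intro j
    induction j using Fin.cases with
    | zero =>
      have : Finset.Iio (0 : Fin (d + 1)) = ∅ := by ext k; simp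
      simp [this, hr0, orderStat_zero, hδ]
    | succ l =>
      obtain ⟨i, hi, hxi⟩ := hr l
      obtain ⟨k, rfl⟩ := (Tuple.sort x).surjective i
      have hk : cellMap τ n k = l.castSucc := by rw [← hcell]; exact hi
      rw [hi, ← sum_Iio_succ] at hxi
      obtain ⟨hk1, hk2⟩ := (cellIndex_eq_castSucc_iff hmono hr0).1 hk
      have hn := ranks_le hτ h1 n l.succ
      refine ⟨hxi.trans_le (le_orderStat_of_lt hk2 hn), ?_⟩
      obtain ⟨r, hr⟩ := Nat.exists_eq_succ_of_ne_zero (Nat.ne_zero_of_lt hk2)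
      rw [hr] at hn hk2 ⊢
      have hlast : cellMap τ n ⟨r, hn⟩ = l.castSucc :=
        (cellIndex_eq_castSucc_iff hmono hr0).2
          ⟨hk1.trans (Nat.le_of_lt_succ hk2), hr ▸ Nat.lt_succ_self r⟩
      have := (hx (Tuple.sort x ⟨r, hn⟩)).2
      rw [show f (Tuple.sort x ⟨r, hn⟩) = l.castSucc by rw [← hlast, ← hcell]; rfl,
        ← sum_Iio_succ] at this
      rwa [← orderStat_succ x ⟨r, hn⟩] at this
  have hs := sum_Iio_succ (completion y) l
  rw [completion_castSucc] at hs
  obtain ⟨h2, h3⟩ := hT l.castSucc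
  obtain ⟨h4, h5⟩ := hT l.succ
  rw [increments_apply, abs_lt]
  constructor <;> linarith

theorem prod_comp_rearrangement {M : Type*} [CommMonoid M] {f : Fin n → Fin (d + 1)}
    (hf : f ∈ rearrangements (cellMap τ n)) (w : Fin (d + 1) → M) :
    ∏ i, w (f i) = ∏ j, w j ^ cellCard τ n j := by
  obtain ⟨σ, -, rfl⟩ := Finset.mem_image.1 hf
  rw [Fintype.prod_equiv σ (fun i => w ((cellMap τ n ∘ σ) i)) (fun i => w (cellMap τ n i))
    fun _ => rfl, ← Fintype.prod_fiberwise' (cellMap τ n) w]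
  simp [cellCard]

theorem exists_of_mem_rearrangements {f : Fin n → Fin (d + 1)}
    (hf : f ∈ rearrangements (cellMap τ n)) {j : Fin (d + 1)} (hj : 0 < cellCard τ n j) :
    ∃ i, f i = j := by
  obtain ⟨σ, -, rfl⟩ := Finset.mem_image.1 hf
  obtain ⟨⟨i, hi⟩⟩ := Fintype.card_pos_iff.1 hj
  exact ⟨σ⁻¹ i, by simpa using hi⟩

end

/-! ### Probability estimates for balls of increments -/

section

variable {Ω : Type*} [MeasurableSpace Ω] {P : Measure Ω}

theorem measure_preimage_of_isUniform {X : Ω → ℝ} (hX : pdf.IsUniform X (Icc (0 : ℝ) 1) P volume)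
    {A : Set ℝ} (hA : MeasurableSet A) : P (X ⁻¹' A) = volume (Icc (0 : ℝ) 1 ∩ A) := by
  rw [hX.measure_preimage (by simp) (by simp) hA]
  simp

theorem measure_preimage_Icc_le {X : Ω → ℝ} (hX : pdf.IsUniform X (Icc (0 : ℝ) 1) P volume)
    (u v : ℝ) : P (X ⁻¹' Icc u v) ≤ ENNReal.ofReal (v - u) := by
  rw [measure_preimage_of_isUniform hX measurableSet_Icc, ← Real.volume_Icc]
  exact measure_mono inter_subset_right

theorem measure_preimage_Ioc {X : Ω → ℝ} (hX : pdf.IsUniform X (Icc (0 : ℝ) 1) P volume)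
    {u v : ℝ} (hu : 0 ≤ u) (hv : v ≤ 1) : P (X ⁻¹' Ioc u v) = ENNReal.ofReal (v - u) := by
  have h : Ioc u v ⊆ Icc 0 1 := fun x hx => ⟨hu.trans hx.1.le, hx.2.trans hv⟩
  rw [measure_preimage_of_isUniform hX measurableSet_Ioc, ← Real.volume_Ioc, inter_eq_right.2 h]

theorem ae_mem_Icc_of_isUniform {n : ℕ} {X : Fin n → Ω → ℝ} [IsProbabilityMeasure P]
    (hmeas : ∀ i, Measurable (X i)) (hX : ∀ i, pdf.IsUniform (X i) (Icc (0 : ℝ) 1) P volume) :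
    ∀ᵐ ω ∂P, ∀ i, X i ω ∈ Icc (0 : ℝ) 1 := by
  refine ae_all_iff.2 fun i => ?_
  have : P (X i ⁻¹' Icc 0 1) = 1 := by
    rw [measure_preimage_of_isUniform (hX i) measurableSet_Icc]
    simp
  exact (prob_compl_eq_zero_iff (hmeas i measurableSet_Icc)).2 this

theorem measure_forall_mem {n : ℕ} {X : Fin n → Ω → ℝ} (hind : iIndepFun X P)
    {A : Fin n → Set ℝ} (hA : ∀ i, MeasurableSet (A i)) :
    P {ω | ∀ i, X i ω ∈ A i} = ∏ i, P (X i ⁻¹' A i) := by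
  rw [← hind.measure_inter_preimage_eq_mul Finset.univ fun i _ => hA i]
  congr 1
  ext ω
  simp

end

section

variable {Ω : Type*} [MeasurableSpace Ω] {P : Measure Ω}
  {d n : ℕ} {τ : Fin (d + 1) → ℝ} {X : Fin n → Ω → ℝ}

theorem measure_increments_near_le [IsProbabilityMeasure P] (hmeas : ∀ i, Measurable (X i))
    (hind : iIndepFun X P) (hX : ∀ i, pdf.IsUniform (X i) (Icc (0 : ℝ) 1) P volume)
    (hτ0 : τ 0 = 0) (hτ : StrictMono τ) (h1 : τ (Fin.last d) ≤ 1) {y : Fin d → ℝ}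
    (hy : ∀ j, 0 ≤ completion y j) {δ : ℝ} (hδ : 0 ≤ δ) :
    P {ω | ∀ l, |increments τ (fun i => X i ω) l - y l| ≤ δ} ≤
      ENNReal.ofReal ((rearrangements (cellMap τ n)).card
        * ∏ j, (completion y j + 2 * ((d + 1) * δ)) ^ cellCard τ n j) := by
  have hw : ∀ j, 0 ≤ completion y j + 2 * ((d + 1) * δ) := fun j => by
    have := hy j
    positivity
  let A : (Fin n → Fin (d + 1)) → Fin n → Set ℝ := fun f i =>
    Icc (∑ k ∈ Finset.Iio (f i), completion y k - (d + 1) * δ)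
      (∑ k ∈ Finset.Iio (f i), completion y k + completion y (f i) + (d + 1) * δ)
  calc P {ω | ∀ l, |increments τ (fun i => X i ω) l - y l| ≤ δ}
      ≤ P (⋃ f ∈ rearrangements (cellMap τ n), {ω | ∀ i, X i ω ∈ A f i}) := by
        refine measure_mono_ae ?_
        filter_upwards [ae_mem_Icc_of_isUniform hmeas hX] with ω hω h
        obtain ⟨f, hf, hfx⟩ := exists_rearrangement_of_increments_near hτ0 hτ h1 hω hδ h
        exact mem_iUnion₂.2 ⟨f, hf, hfx⟩
    _ ≤ ∑ f ∈ rearrangements (cellMap τ n), P {ω | ∀ i, X i ω ∈ A f i} :=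
        measure_biUnion_finset_le _ _
    _ ≤ ∑ f ∈ rearrangements (cellMap τ n),
          ENNReal.ofReal (∏ j, (completion y j + 2 * ((d + 1) * δ)) ^ cellCard τ n j) := by
        refine Finset.sum_le_sum fun f hf => ?_
        rw [measure_forall_mem hind fun i => measurableSet_Icc,
          ← prod_comp_rearrangement hf, ENNReal.ofReal_prod_of_nonneg fun i _ => hw _]
        refine Finset.prod_le_prod' fun i _ => (measure_preimage_Icc_le (hX i) _ _).trans ?_
        refine ENNReal.ofReal_le_ofReal (le_of_eq ?_)
        ring
    _ = _ := by
        rw [Finset.sum_const, nsmul_eq_mul, ENNReal.ofReal_mul (Nat.cast_nonneg _),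
          ENNReal.ofReal_natCast]

theorem pow_le_prod_ite {ι : Type*} [Fintype ι] (p : ι → Prop) [DecidablePred p] {δ : ℝ}
    (hδ : 0 ≤ δ) (hδ1 : δ ≤ 1) (h : (Finset.univ.filter p).card ≤ d) :
    δ ^ d ≤ ∏ i, if p i then δ else 1 := by
  rw [Finset.prod_ite, Finset.prod_const, Finset.prod_const_one, mul_one]
  exact pow_le_pow_of_le_one hδ hδ1 h

theorem le_measure_increments_near (hmeas : ∀ i, Measurable (X i))
    (hind : iIndepFun X P) (hX : ∀ i, pdf.IsUniform (X i) (Icc (0 : ℝ) 1) P volume)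
    (hτ0 : τ 0 = 0) (hτ : StrictMono τ) (h1 : τ (Fin.last d) ≤ 1) {y : Fin d → ℝ}
    (hy : ∀ j, 0 ≤ completion y j) {δ : ℝ} (hδ : 0 < δ) (hδ1 : δ ≤ 1) (hδy : ∀ l, δ ≤ y l)
    (hcard : ∀ l : Fin d, 0 < cellCard τ n l.castSucc) :
    ENNReal.ofReal ((rearrangements (cellMap τ n)).card
        * (∏ j, completion y j ^ cellCard τ n j) * δ ^ d) ≤
      P {ω | ∀ l, |increments τ (fun i => X i ω) l - y l| < δ} := by
  classical
  have hex : ∀ f ∈ rearrangements (cellMap τ n), ∃ r : Fin d → Fin n, ∀ l, f (r l) = l.castSucc :=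
    fun f hf => Classical.skolem.1 fun l => exists_of_mem_rearrangements hf (hcard l)
  -- `choose!` needs a default value for f outside the rearrangements.
  have : Nonempty (Fin d → Fin n) :=
    ⟨(hex (cellMap τ n) (Finset.mem_image.2 ⟨1, Finset.mem_univ _, rfl⟩)).choose⟩
  choose! r hr using hex
  -- The representative of each of the first d cells is confined to the last δ of its interval.
  let A : (Fin n → Fin (d + 1)) → Fin n → Set ℝ := fun f i =>
    Ioc (if ∃ l, r f l = i then ∑ k ∈ Finset.Iio (f i), completion y k + completion y (f i) - δ
      else ∑ k ∈ Finset.Iio (f i), completion y k)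
      (∑ k ∈ Finset.Iio (f i), completion y k + completion y (f i))
  have hlo : ∀ j, 0 ≤ ∑ k ∈ Finset.Iio j, completion y k := fun j =>
    Finset.sum_nonneg fun k _ => hy k
  have hhi : ∀ j, ∑ k ∈ Finset.Iio j, completion y k + completion y j ≤ 1 := by
    intro j
    rw [← sum_completion y, add_comm, ← Finset.sum_insert (by simp)]
    exact Finset.sum_le_sum_of_subset_of_nonneg (Finset.subset_univ _) fun k _ _ => hy k
  have hrδ : ∀ f ∈ rearrangements (cellMap τ n), ∀ i, (∃ l, r f l = i) →
      δ ≤ completion y (f i) := by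
    rintro f hf i ⟨l, rfl⟩
    rw [hr f hf, completion_castSucc]
    exact hδy l
  have hA : ∀ f ∈ rearrangements (cellMap τ n), ∀ i, A f i ⊆
      Ioc (∑ k ∈ Finset.Iio (f i), completion y k)
        (∑ k ∈ Finset.Iio (f i), completion y k + completion y (f i)) := by
    intro f hf i
    refine Ioc_subset_Ioc_left ?_
    split_ifs with h
    · linarith [hrδ f hf i h]
    · exact le_rfl
  calc ENNReal.ofReal ((rearrangements (cellMap τ n)).card
        * (∏ j, completion y j ^ cellCard τ n j) * δ ^ d)
      = ∑ f ∈ rearrangements (cellMap τ n),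
          ENNReal.ofReal ((∏ j, completion y j ^ cellCard τ n j) * δ ^ d) := by
        rw [Finset.sum_const, nsmul_eq_mul, mul_assoc, ENNReal.ofReal_mul (Nat.cast_nonneg _),
          ENNReal.ofReal_natCast]
    _ ≤ ∑ f ∈ rearrangements (cellMap τ n), P {ω | ∀ i, X i ω ∈ A f i} := by
        refine Finset.sum_le_sum fun f hf => ?_
        have hP : ∀ i, P (X i ⁻¹' A f i) =
            ENNReal.ofReal (if ∃ l, r f l = i then δ else completion y (f i)) := by
          intro i
          rw [measure_preimage_Ioc (hX i) _ (hhi _)]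
          · congr 1
            split_ifs <;> ring
          · split_ifs with h
            · linarith [hrδ f hf i h, hlo (f i)]
            · exact hlo _
        rw [measure_forall_mem hind fun i => measurableSet_Ioc,
          Finset.prod_congr rfl fun i _ => hP i,
          ← ENNReal.ofReal_prod_of_nonneg fun i _ => by split_ifs; exacts [hδ.le, hy _]]
        refine ENNReal.ofReal_le_ofReal ?_
        rw [← prod_comp_rearrangement hf]
        have hc : (Finset.univ.filter fun i => ∃ l, r f l = i).card ≤ d := by
          have : (Finset.univ.filter fun i => ∃ l, r f l = i) = Finset.univ.image (r f) := by
            ext i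
            simp
          rw [this]
          exact Finset.card_image_le.trans (by simp)
        -- There are at most d representatives, and a factor z_j replaced by δ is still at least z_j
        -- δ because z_j ≤ 1.
        refine (mul_le_mul_of_nonneg_left (pow_le_prod_ite _ hδ.le hδ1 hc)
          (Finset.prod_nonneg fun i _ => hy _)).trans ?_
        rw [← Finset.prod_mul_distrib]
        refine Finset.prod_le_prod (fun i _ => mul_nonneg (hy _) ?_) fun i _ => ?_
        · split_ifs
          exacts [hδ.le, zero_le_one]
        · split_ifs
          · exact mul_le_of_le_one_left hδ.le (by linarith [hhi (f i), hlo (f i)])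
          · simp
    _ = P (⋃ f ∈ rearrangements (cellMap τ n), {ω | ∀ i, X i ω ∈ A f i}) := by
        refine (measure_biUnion_finset (fun f hf g hg hfg => ?_) fun f _ => ?_).symm
        · refine disjoint_left.2 fun ω hω hω' => hfg ?_
          have e1 := comp_sort_eq_cellMap hτ0 hτ hy hf fun i => hA f hf i (hω i)
          have e2 := comp_sort_eq_cellMap hτ0 hτ hy hg fun i => hA g hg i (hω' i)
          exact (Tuple.sort fun i => X i ω).surjective.injective_comp_right (e1.trans e2.symm)
        · rw [ofPred_forall]
          exact MeasurableSet.iInter fun i => hmeas i measurableSet_Ioc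
    _ ≤ _ := by
        refine measure_mono (iUnion₂_subset fun f hf ω hω => ?_)
        refine abs_increments_sub_lt hτ0 hτ h1 hy hδ hf (fun i => hA f hf i (hω i)) fun l =>
          ⟨r f l, hr f hf l, ?_⟩
        have := (hω (r f l)).1
        rwa [if_pos ⟨l, rfl⟩] at this

end

/-! ### The large deviation bounds -/

theorem tendsto_log_ofReal_div {q : ℕ → ℝ} {L : ℝ} (hq : ∀ᶠ n in atTop, 0 < q n)
    (hL : Tendsto (fun n : ℕ => Real.log (q n) / n) atTop (𝓝 L)) :
    Tendsto (fun n : ℕ => ENNReal.log (ENNReal.ofReal (q n)) / (n : EReal)) atTop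
      (𝓝 (L : EReal)) := by
  refine ((continuous_coe_real_ereal.tendsto L).comp hL).congr' ?_
  filter_upwards [hq] with n hn
  rw [ENNReal.log_ofReal_of_pos hn, Function.comp_apply, EReal.coe_div, EReal.coe_natCast]

theorem limsup_log_div_le {p : ℕ → ℝ≥0∞} {q : ℕ → ℝ} {L : ℝ} (hq : ∀ᶠ n in atTop, 0 < q n)
    (hL : Tendsto (fun n : ℕ => Real.log (q n) / n) atTop (𝓝 L))
    (h : ∀ᶠ n in atTop, p n ≤ ENNReal.ofReal (q n)) :
    limsup (fun n : ℕ => ENNReal.log (p n) / (n : EReal)) atTop ≤ L := by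
  rw [← (tendsto_log_ofReal_div hq hL).limsup_eq]
  refine limsup_le_limsup ?_
  filter_upwards [h] with n hn
  exact EReal.div_le_div_right_of_nonneg (Nat.cast_nonneg' n) (ENNReal.log_monotone hn)

theorem le_liminf_log_div {p : ℕ → ℝ≥0∞} {q : ℕ → ℝ} {L : ℝ} (hq : ∀ᶠ n in atTop, 0 < q n)
    (hL : Tendsto (fun n : ℕ => Real.log (q n) / n) atTop (𝓝 L))
    (h : ∀ᶠ n in atTop, ENNReal.ofReal (q n) ≤ p n) :
    L ≤ liminf (fun n : ℕ => ENNReal.log (p n) / (n : EReal)) atTop := by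
  rw [← (tendsto_log_ofReal_div hq hL).liminf_eq]
  refine liminf_le_liminf ?_
  filter_upwards [h] with n hn
  exact EReal.div_le_div_right_of_nonneg (Nat.cast_nonneg' n) (ENNReal.log_monotone hn)

theorem completion_nonneg {d : ℕ} {y : Fin d → ℝ} (hy : y ∈ subSimplex d) (j : Fin (d + 1)) :
    0 ≤ completion y j := by
  induction j using Fin.lastCases with
  | last => simpa using hy.2
  | cast i => simpa using hy.1 i

/-- The explicit rate stays above a level `M < explicitRate τ y` after a small enlargement of all
coordinates. -/
theorem exists_lt_sum_of_lt_explicitRate {d : ℕ} {τ : Fin (d + 1) → ℝ} (hτ0 : τ 0 = 0)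
    (hτ : StrictMono τ) (h1 : τ (Fin.last d) ≤ 1) {y : Fin d → ℝ} (hy : y ∈ subSimplex d) {M : ℝ}
    (hM : (M : EReal) < explicitRate τ y) :
    ∃ ε > 0, M < ∑ j, weights τ j * Real.log (weights τ j / (completion y j + ε)) := by
  rw [← conjugate_completion hτ0 hτ h1, conjugate_eq_iSup] at hM
  obtain ⟨b, hb⟩ := lt_iSup_iff.1 hM
  obtain ⟨hb0, hb⟩ := lt_iSup_iff.1 hb
  rw [EReal.coe_lt_coe_iff, Finset.sum_add_distrib, Finset.sum_sub_distrib, sum_completion] at hb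
  have hB : 0 ≤ ∑ j, b j := Finset.sum_nonneg fun j _ => (hb0 j).le
  set g := 1 - ∑ j, b j * completion y j + ∑ j, weights τ j * Real.log (b j) - M with hg
  have hg0 : 0 < g := by linarith
  -- Take a dual point b whose value exceeds M by g; shifting z by ε costs at most ε ∑ b_j < g.
  -- Duality also covers boundary y, where the rate may be infinite.
  refine ⟨g / (∑ j, b j + 1), by positivity, ?_⟩
  set ε := g / (∑ j, b j + 1) with hε
  have hε0 : 0 < ε := by positivity
  have hεB : ε * ∑ j, b j < g := by
    rw [hε, div_mul_eq_mul_div, div_lt_iff₀ (by positivity)]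
    linarith
  have h := Finset.sum_le_sum fun j (_ : j ∈ Finset.univ) => fenchel_le (weights_nonneg hτ h1 j)
    (Or.inl (add_pos_of_nonneg_of_pos (completion_nonneg hy j) hε0)) (hb0 j)
  simp only [Finset.sum_add_distrib, Finset.sum_sub_distrib, mul_add, sum_weights hτ0,
    sum_completion, ← Finset.sum_mul] at h
  linarith

section

variable {Ω : Type*} [MeasurableSpace Ω] {P : Measure Ω}
  {U : (n : ℕ) → Fin n → Ω → ℝ} {d : ℕ} {τ : Fin (d + 1) → ℝ}

theorem exists_eventually_measure_near_le [IsProbabilityMeasure P]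
    (hmeas : ∀ n i, Measurable (U n i))
    (hindep : ∀ n, iIndepFun (U n) P)
    (hunif : ∀ n i, pdf.IsUniform (U n i) (Icc (0 : ℝ) 1) P volume)
    (hτ0 : τ 0 = 0) (hτ : StrictMono τ) (h1 : τ (Fin.last d) ≤ 1) {y : Fin d → ℝ}
    (hy : y ∈ subSimplex d) {M : ℝ} (hM : (M : EReal) < explicitRate τ y) :
    ∃ δ > 0, ∀ᶠ n : ℕ in atTop,
      P {ω | ∀ l, |increments τ (fun i => U n i ω) l - y l| ≤ δ} ≤
        ENNReal.ofReal (Real.exp (-(n * M))) := by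
  obtain ⟨ε, hε, hMε⟩ := exists_lt_sum_of_lt_explicitRate hτ0 hτ h1 hy hM
  refine ⟨ε / (2 * (d + 1)), by positivity, ?_⟩
  have hz : ∀ j, 0 < completion y j + ε ∨ (weights τ j = 0 ∧ completion y j + ε = 0) :=
    fun j => Or.inl (add_pos_of_nonneg_of_pos (completion_nonneg hy j) hε)
  filter_upwards [(tendsto_log_card_rearrangements_mul hτ0 hτ h1 hz).eventually_lt_const
    (neg_lt_neg hMε), eventually_gt_atTop 0] with n hn hn0
  refine (measure_increments_near_le (hmeas n) (hindep n) (hunif n) hτ0 hτ h1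
    (completion_nonneg hy) (by positivity)).trans (ENNReal.ofReal_le_ofReal ?_)
  rw [show 2 * ((d + 1) * (ε / (2 * (d + 1)))) = ε by field_simp,
    ← Real.log_le_iff_le_exp (card_rearrangements_mul_prod_pos hτ0 hτ hz n)]
  rw [div_lt_iff₀ (by positivity)] at hn
  linarith

theorem limsup_log_measure_increments_le [IsProbabilityMeasure P]
    (hmeas : ∀ n i, Measurable (U n i))
    (hindep : ∀ n, iIndepFun (U n) P)
    (hunif : ∀ n i, pdf.IsUniform (U n i) (Icc (0 : ℝ) 1) P volume)
    (hτ0 : τ 0 = 0) (hτ : StrictMono τ) (h1 : τ (Fin.last d) ≤ 1) {F : Set (Fin d → ℝ)}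
    (hF : IsClosed F) :
    limsup (fun n : ℕ => ENNReal.log (P {ω | increments τ (fun i => U n i ω) ∈ F}) / (n : EReal))
      atTop ≤ -(⨅ y ∈ F, explicitRate τ y) := by
  -- It suffices to treat every real M below the infimum, which also handles an infinite infimum.
  refine EReal.le_neg.2 (EReal.ge_of_forall_gt_iff_ge.1 fun M hM => EReal.le_neg.1 ?_)
  have hloc : ∀ y ∈ F ∩ subSimplex d, ∃ δ > 0, ∀ᶠ n : ℕ in atTop,
      P {ω | ∀ l, |increments τ (fun i => U n i ω) l - y l| ≤ δ} ≤
        ENNReal.ofReal (Real.exp (-(n * M))) := fun y hy =>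
    exists_eventually_measure_near_le hmeas hindep hunif hτ0 hτ h1 hy.2
      (hM.trans_le (iInf₂_le y hy.1))
  choose! δ hδ hloc using hloc
  obtain ⟨s, hsF, hs⟩ := ((isCompact_subSimplex d).inter_left hF).elim_nhds_subcover
    (fun y => Metric.ball y (δ y)) fun y hy => Metric.ball_mem_nhds y (hδ y hy)
  -- The extra 1 keeps the bound positive when the finite cover is empty.
  have hpos : ∀ n : ℕ, 0 < ((s.card : ℝ) + 1) * Real.exp (-(n * M)) := fun n => by positivity
  rw [← EReal.coe_neg]
  refine limsup_log_div_le (q := fun n => ((s.card : ℝ) + 1) * Real.exp (-(n * M)))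
    (Eventually.of_forall hpos) ?_ ?_
  · have hc : Tendsto (fun n : ℕ => Real.log ((s.card : ℝ) + 1) / n - M) atTop (𝓝 (0 - M)) :=
      (tendsto_const_nhds.div_atTop tendsto_natCast_atTop_atTop).sub_const M
    rw [zero_sub] at hc
    refine hc.congr' ?_
    filter_upwards [eventually_gt_atTop 0] with n hn
    have hn' : (n : ℝ) ≠ 0 := by positivity
    rw [Real.log_mul (by positivity) (Real.exp_pos _).ne', Real.log_exp]
    field_simp
    ring
  · filter_upwards [(Finset.eventually_all s).2 fun y hy => hloc y (hsF y hy)] with n hn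
    calc P {ω | increments τ (fun i => U n i ω) ∈ F}
        ≤ P (⋃ y ∈ s, {ω | ∀ l, |increments τ (fun i => U n i ω) l - y l| ≤ δ y}) := by
          refine measure_mono_ae ?_
          filter_upwards [ae_mem_Icc_of_isUniform (hmeas n) (hunif n)] with ω hω hωF
          obtain ⟨y, hy, hyω⟩ := mem_iUnion₂.1
            (hs ⟨hωF, increments_mem_subSimplex hτ0 hτ h1 hω⟩)
          exact mem_iUnion₂.2 ⟨y, hy, fun l =>
            (dist_le_pi_dist _ _ l).trans (Metric.mem_ball.1 hyω).le⟩
      _ ≤ ∑ y ∈ s, P {ω | ∀ l, |increments τ (fun i => U n i ω) l - y l| ≤ δ y} :=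
          measure_biUnion_finset_le _ _
      _ ≤ ∑ y ∈ s, ENNReal.ofReal (Real.exp (-(n * M))) := Finset.sum_le_sum hn
      _ = ENNReal.ofReal (s.card * Real.exp (-(n * M))) := by
          rw [Finset.sum_const, nsmul_eq_mul, ENNReal.ofReal_mul (Nat.cast_nonneg _),
            ENNReal.ofReal_natCast]
      _ ≤ _ := by
          refine ENNReal.ofReal_le_ofReal (mul_le_mul_of_nonneg_right ?_ (Real.exp_pos _).le)
          linarith

theorem le_liminf_log_measure_increments (hmeas : ∀ n i, Measurable (U n i))
    (hindep : ∀ n, iIndepFun (U n) P)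
    (hunif : ∀ n i, pdf.IsUniform (U n i) (Icc (0 : ℝ) 1) P volume)
    (hτ0 : τ 0 = 0) (hτ : StrictMono τ) (h1 : τ (Fin.last d) ≤ 1) {G : Set (Fin d → ℝ)}
    (hG : IsOpen G) {y : Fin d → ℝ} (hyG : y ∈ G) :
    -explicitRate τ y ≤ liminf (fun n : ℕ =>
      ENNReal.log (P {ω | increments τ (fun i => U n i ω) ∈ G}) / (n : EReal)) atTop := by
  by_cases hy : ∀ j, 0 < completion y j ∨ (weights τ j = 0 ∧ completion y j = 0)
  swap
  · push Not at hy
    obtain ⟨j, hj⟩ := hy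
    rw [explicitRate_eq_top (j := j) (by push Not; exact hj), EReal.neg_top]
    exact bot_le
  have hy0 : ∀ j, 0 ≤ completion y j := fun j => by
    rcases hy j with h | ⟨-, h⟩ <;> simp [h, le_of_lt]
  have hypos : ∀ l, 0 < y l := fun l => by
    simpa using (hy l.castSucc).resolve_right fun h => (weights_castSucc_pos hτ l).ne' h.1
  obtain ⟨ε, hε, hεG⟩ := Metric.isOpen_iff.1 hG y hyG
  have hev : ∀ᶠ δ : ℝ in 𝓝[>] 0, 0 < δ ∧ δ ≤ 1 ∧ δ < ε ∧ ∀ l, δ ≤ y l := by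
    refine eventually_mem_nhdsWithin.and (nhdsWithin_le_nhds ?_)
    exact (eventually_le_nhds one_pos).and ((eventually_lt_nhds hε).and
      (eventually_all.2 fun l => eventually_le_nhds (hypos l)))
  obtain ⟨δ, hδ, hδ1, hδε, hδy⟩ := hev.exists
  rw [explicitRate_eq_coe hy, ← EReal.coe_neg]
  have hpos := card_rearrangements_mul_prod_pos hτ0 hτ hy
  refine le_liminf_log_div (q := fun n => (rearrangements (cellMap τ n)).card
        * (∏ j, completion y j ^ cellCard τ n j) * δ ^ d)
    (Eventually.of_forall fun n => mul_pos (hpos n) (pow_pos hδ d)) ?_ ?_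
  · have hc : Tendsto (fun n : ℕ => Real.log (δ ^ d) / n) atTop (𝓝 0) :=
      tendsto_const_nhds.div_atTop tendsto_natCast_atTop_atTop
    have := (tendsto_log_card_rearrangements_mul hτ0 hτ h1 hy).add hc
    rw [add_zero] at this
    refine this.congr fun n => ?_
    rw [Real.log_mul (hpos n).ne' (pow_pos hδ d).ne', add_div]
  · have hcard : ∀ᶠ n in atTop, ∀ l : Fin d, 0 < cellCard τ n l.castSucc := by
      refine eventually_all.2 fun l => ?_
      filter_upwards [(tendsto_cellCard_div hτ0 hτ h1 l.castSucc).eventually_const_lt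
        (weights_castSucc_pos hτ l)] with n hn
      by_contra h
      rw [Nat.eq_zero_of_not_pos h] at hn
      simp at hn
    filter_upwards [hcard] with n hn
    refine (le_measure_increments_near (hmeas n) (hindep n) (hunif n) hτ0 hτ h1 hy0 hδ hδ1 hδy
      hn).trans (measure_mono fun ω hω => hεG ?_)
    rw [Metric.mem_ball, dist_pi_lt_iff hε]
    exact fun l => (hω l).trans hδε

theorem satisfiesLDP_explicitRate [IsProbabilityMeasure P]
    (hmeas : ∀ n i, Measurable (U n i))
    (hindep : ∀ n, iIndepFun (U n) P)
    (hunif : ∀ n i, pdf.IsUniform (U n i) (Icc (0 : ℝ) 1) P volume)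
    (hτ0 : τ 0 = 0) (hτ : StrictMono τ) (h1 : τ (Fin.last d) ≤ 1) :
    SatisfiesLDP P (fun n ω => increments τ (fun i => U n i ω)) (explicitRate τ) where
  lower _ hG := EReal.neg_le.1 (le_iInf₂ fun _ hy =>
    EReal.neg_le.1 (le_liminf_log_measure_increments hmeas hindep hunif hτ0 hτ h1 hG hy))
  upper _ hF := limsup_log_measure_increments_le hmeas hindep hunif hτ0 hτ h1 hF

end

end OrderStatLDP

theorem mainTheorem6 {Ω : Type*} [MeasurableSpace Ω] (P : Measure Ω) [IsProbabilityMeasure P]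
    (U : (n : ℕ) → Fin n → Ω → ℝ)
    (hmeas : ∀ n i, Measurable (U n i))
    (hindep : ∀ n, iIndepFun (U n) P)
    (hunif : ∀ n i, pdf.IsUniform (U n i) (Set.Icc (0 : ℝ) 1) P volume)
    (t : ℝ) (ht : t ≤ 1) (d : ℕ) (τ : Fin (d + 1) → ℝ)
    (hτ0 : τ 0 = 0) (hτ : StrictMono τ) (hτt : τ (Fin.last d) = t) :
    OrderStatLDP.IsGoodRateFunction (OrderStatLDP.contractedRate τ) ∧
    OrderStatLDP.SatisfiesLDP P
      (fun n ω => OrderStatLDP.increments τ (fun i => U n i ω))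
      (OrderStatLDP.contractedRate τ) ∧
    (∀ y : Fin d → ℝ, OrderStatLDP.contractedRate τ y = OrderStatLDP.explicitRate τ y) ∧
    (∀ y : Fin d → ℝ, (∀ i, y i ∈ Set.Ioc (0 : ℝ) 1) → ∑ l, y l < 1 →
      OrderStatLDP.contractedRate τ y =
        (((∑ i : Fin d, (τ i.succ - τ i.castSucc) *
              Real.log ((τ i.succ - τ i.castSucc) / y i))
          + (1 - t) * Real.log ((1 - t) / (1 - ∑ l, y l)) : ℝ) : EReal)) := by
  subst hτt
  have hrate := OrderStatLDP.contractedRate_eq_explicitRate hτ0 hτ ht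
  rw [show OrderStatLDP.contractedRate τ = OrderStatLDP.explicitRate τ from funext hrate]
  refine ⟨OrderStatLDP.isGoodRateFunction_explicitRate hτ0 hτ ht,
    OrderStatLDP.satisfiesLDP_explicitRate hmeas hindep hunif hτ0 hτ ht, fun _ => rfl,
    fun y hy hsum => ?_⟩
  rw [OrderStatLDP.explicitRate_eq_coe, Fin.sum_univ_castSucc]
  · simp
  · intro j
    left
    induction j using Fin.lastCases with
    | last => simpa using hsum
    | cast i => simpa using (hy i).1
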